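/- For $0<\lambda<1/2$ let $K_\lambda$ be the middle Cantor set with ratio $\lambda$, that is, the attractor of the iterated function system $x\mapsto\lambda x$, $x\mapsto\lambda x+1-\lambda$ (the unique nonempty compact $K\subset\mathbb R$ with $K=\lambda K\cup(\lambda K+1-\lambda)$). Let $d\ge 2$, let $0<\lambda_i<1/2$ for $1\le i\le d$, and suppose that for every $1\le i\le d-1$ $$\frac{1-2\lambda_i}{\lambda_i}\le 1-\lambda_d\qquad\text{and}\qquad \frac{1}{1-\lambda_i}\le\frac{\lambda_d}{1-2\lambda_d}.$$ Let $\epsilon_1,\dots,\epsilon_d\in\{-1,1\}$, with $\epsilon_i=1$ for at least one $i$. Then $$\Big\{\prod_{i=1}^d x_i^{\epsilon_i} : x_i\in K_{\lambda_i}\text{ for all } i,\ x_i\ne 0\text{ whenever }\epsilon_i=-1\Big\}=\{0\}\cup\bigcup_{k_1,\dots,k_d\in\mathbb N}\lambda_1^{\epsilon_1k_1}\lambda_2^{\epsilon_2k_2}\cdots\lambda_d^{\epsilon_dk_d}\,[\delta,\eta],$$ where $\mathbb N=\{0,1,2,\dots\}$, $\delta=\prod_{i:\,\epsilon_i=1}(1-\lambda_i)$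 and $\eta=\prod_{i:\,\epsilon_i=-1}(1-\lambda_i)^{-1}$ (an empty product is $1$). -/

import Mathlib

open Set

/-- The `n`-th level of the construction of the middle Cantor set with ratio `l`: start from
`[0,1]` and apply the two maps `x ↦ l x` and `x ↦ l x + 1 - l` repeatedly. Going from one level to
the next removes the open middle part of relative length `1 - 2 l` of every interval. -/
def cantorLevel (l : ℝ) : ℕ → Set ℝ
  | 0 => Icc 0 1
  | n + 1 => (fun x => l * x) '' cantorLevel l n ∪ (fun x => l * x + (1 - l)) '' cantorLevel l n

/-- The middle Cantor set with ratio `l` (meant for `0 < l < 1/2`). By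
`isAttractor_iff_eq_middleCantor` it is the attractor of the iterated function system
`x ↦ l x`, `x ↦ l x + 1 - l`. -/
def middleCantor (l : ℝ) : Set ℝ := ⋂ n, cantorLevel l n

/-- `K` is an attractor (self-similar set) of the iterated function system
`x ↦ l x`, `x ↦ l x + 1 - l`. -/
structure IsAttractor (l : ℝ) (K : Set ℝ) : Prop where
  isCompact : IsCompact K
  nonempty : K.Nonempty
  eq_union : K = (fun x => l * x) '' K ∪ (fun x => l * x + (1 - l)) '' K

/-- The mixed product/quotient set `{∏ i, x i ^ e i : x i ∈ K i, x i ≠ 0 if e i = -1}`. -/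
def mixedProduct {d : ℕ} (K : Fin d → Set ℝ) (e : Fin d → ℤ) : Set ℝ :=
  {y | ∃ x : Fin d → ℝ, (∀ i, x i ∈ K i) ∧ (∀ i, e i = -1 → x i ≠ 0) ∧ y = ∏ i, x i ^ e i}

theorem cantorLevel_subset_Icc {l : ℝ} (h0 : 0 < l) (h1 : l < 1 / 2) (n : ℕ) :
    cantorLevel l n ⊆ Icc 0 1 := by
  induction n with
  | zero => exact subset_rfl
  | succ n ih =>
    rintro x (⟨y, hy, rfl⟩ | ⟨y, hy, rfl⟩) <;> obtain ⟨hy0, hy1⟩ := ih hy <;>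
      constructor <;> dsimp only <;> nlinarith

/-- The middle Cantor set is the attractor, and the only one, of its two maps. -/
theorem isAttractor_iff_eq_middleCantor {l : ℝ} (h0 : 0 < l) (h1 : l < 1 / 2) (K : Set ℝ) :
    IsAttractor l K ↔ K = middleCantor l := by
  have hcont0 : Continuous fun x : ℝ => l * x := by fun_prop
  have hcont1 : Continuous fun x : ℝ => l * x + (1 - l) := by fun_prop
  have hcomp : ∀ n, IsCompact (cantorLevel l n) := by
    intro n
    induction n with
    | zero => exact isCompact_Icc
    | succ n ih => exact (ih.image hcont0).union (ih.image hcont1)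
  have hzero : ∀ n, (0 : ℝ) ∈ cantorLevel l n := by
    intro n
    induction n with
    | zero => exact ⟨le_rfl, zero_le_one⟩
    | succ n ih => exact Or.inl ⟨0, ih, by simp⟩
  constructor
  · intro hK
    have hsub : K ⊆ Icc 0 1 := by
      obtain ⟨M, hM, hMax⟩ := hK.isCompact.exists_isGreatest hK.nonempty
      obtain ⟨m, hm, hMin⟩ := hK.isCompact.exists_isLeast hK.nonempty
      have hM1 : M ≤ 1 := by
        have h := hM
        rw [hK.eq_union] at h
        obtain ⟨y, hy, hyM⟩ | ⟨y, hy, hyM⟩ := h <;> have := hMax hy <;> dsimp only at hyM <;>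
          nlinarith
      have hm0 : 0 ≤ m := by
        have h := hm
        rw [hK.eq_union] at h
        obtain ⟨y, hy, hym⟩ | ⟨y, hy, hym⟩ := h <;> have := hMin hy <;> dsimp only at hym <;>
          nlinarith
      intro x hx
      exact ⟨hm0.trans (hMin hx), (hMax hx).trans hM1⟩
    apply Subset.antisymm
    · refine subset_iInter fun n => ?_
      induction n with
      | zero => exact hsub
      | succ n ih =>
        rw [hK.eq_union]
        exact union_subset_union (image_mono ih) (image_mono ih)
    · have happrox : ∀ n, ∀ x ∈ cantorLevel l n, ∃ y ∈ K, |x - y| ≤ l ^ n := by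
        intro n
        induction n with
        | zero =>
          intro x hx
          obtain ⟨y, hy⟩ := hK.nonempty
          have hy' := hsub hy
          refine ⟨y, hy, ?_⟩
          rw [pow_zero, abs_le]
          constructor <;> linarith [hx.1, hx.2, hy'.1, hy'.2]
        | succ n ih =>
          rintro x (⟨z, hz, rfl⟩ | ⟨z, hz, rfl⟩) <;> obtain ⟨y, hy, hzy⟩ := ih z hz
          · refine ⟨l * y, ?_, ?_⟩
            · rw [hK.eq_union]
              exact Or.inl ⟨y, hy, rfl⟩
            · dsimp only
              rw [← mul_sub, abs_mul, abs_of_pos h0, pow_succ']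
              exact mul_le_mul_of_nonneg_left hzy h0.le
          · refine ⟨l * y + (1 - l), ?_, ?_⟩
            · rw [hK.eq_union]
              exact Or.inr ⟨y, hy, rfl⟩
            · dsimp only
              rw [add_sub_add_right_eq_sub, ← mul_sub, abs_mul, abs_of_pos h0, pow_succ']
              exact mul_le_mul_of_nonneg_left hzy h0.le
      intro x hx
      rw [← hK.isCompact.isClosed.closure_eq, Metric.mem_closure_iff]
      intro r hr
      obtain ⟨n, hn⟩ := exists_pow_lt_of_lt_one hr (show l < 1 by linarith)
      obtain ⟨y, hy, hxy⟩ := happrox n x (mem_iInter.1 hx n)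
      exact ⟨y, hy, by rw [Real.dist_eq]; exact hxy.trans_lt hn⟩
  · rintro rfl
    have hanti : ∀ n, cantorLevel l (n + 1) ⊆ cantorLevel l n := by
      intro n
      induction n with
      | zero => exact cantorLevel_subset_Icc h0 h1 1
      | succ n ih => exact union_subset_union (image_mono ih) (image_mono ih)
    refine ⟨?_, ⟨0, mem_iInter.2 hzero⟩, ?_⟩
    · exact (hcomp 0).of_isClosed_subset (isClosed_iInter fun n => (hcomp n).isClosed)
        (iInter_subset _ 0)
    · apply Subset.antisymm
      · intro x hx
        have hx' := fun n => mem_iInter.1 hx (n + 1)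
        rcases le_or_gt x (1 / 2) with hle | hgt
        · refine Or.inl ⟨x / l, mem_iInter.2 fun n => ?_, by field_simp⟩
          obtain ⟨y, hy, hyx⟩ | ⟨y, hy, hyx⟩ := hx' n
          · rw [← hyx]
            simpa [h0.ne'] using hy
          · exfalso
            have := (cantorLevel_subset_Icc h0 h1 n hy).1
            dsimp only at hyx
            nlinarith
        · refine Or.inr ⟨(x - (1 - l)) / l, mem_iInter.2 fun n => ?_, by field_simp; ring⟩
          obtain ⟨y, hy, hyx⟩ | ⟨y, hy, hyx⟩ := hx' n
          · exfalso
            have := (cantorLevel_subset_Icc h0 h1 n hy).2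
            dsimp only at hyx
            nlinarith
          · rw [← hyx]
            simpa [h0.ne'] using hy
      · intro x hx
        refine mem_iInter.2 fun n => hanti n ?_
        obtain ⟨y, hy, rfl⟩ | ⟨y, hy, rfl⟩ := hx
        · exact Or.inl ⟨y, mem_iInter.1 hy n, rfl⟩
        · exact Or.inr ⟨y, mem_iInter.1 hy n, rfl⟩

/-! A nonzero point of $K_\lambda$ is a power of $\lambda$ times a point of $[1-\lambda,1]$, so
everything reduces to showing that products of $x_i^{\epsilon_i}$ with $x_i\in
K_{\lambda_i}\cap[1-\lambda_i,1]$ fill $[\delta,\eta]$. For two Cantor sets this is a gap argument: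
halve one interval of a pair at a time, keeping the target in the range of the pair. No value is
lost as long as the removed gap is relatively smaller than the other interval, and the two
inequalities on the ratios let this go on forever if the interval to cut is well chosen
(`exists_small_cylinders`). Compactness then gives an exact solution. One such pair is enough: every
further factor contributes only its two extreme values, whose multiples of the range already overlap
(`FactorsFill.insert`). -/

/-! ### Self-similarity of the Cantor set. -/

theorem middleCantor_isAttractor {l : ℝ} (hl : 0 < l ∧ l < 1 / 2) :
    IsAttractor l (middleCantor l) :=
  (isAttractor_iff_eq_middleCantor hl.1 hl.2 _).2 rfl

theorem middleCantor_subset_Icc {l : ℝ} : middleCantor l ⊆ Icc 0 1 :=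
  iInter_subset (fun n => cantorLevel l n) 0

theorem mul_mem_middleCantor {l x : ℝ} (hl : 0 < l ∧ l < 1 / 2) (hx : x ∈ middleCantor l) :
    l * x ∈ middleCantor l := by
  rw [(middleCantor_isAttractor hl).eq_union]
  exact Or.inl ⟨x, hx, rfl⟩

theorem mul_add_mem_middleCantor {l x : ℝ} (hl : 0 < l ∧ l < 1 / 2) (hx : x ∈ middleCantor l) :
    l * x + (1 - l) ∈ middleCantor l := by
  rw [(middleCantor_isAttractor hl).eq_union]
  exact Or.inr ⟨x, hx, rfl⟩

theorem pow_mul_mem_middleCantor {l x : ℝ} (hl : 0 < l ∧ l < 1 / 2) (hx : x ∈ middleCantor l)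
    (k : ℕ) : l ^ k * x ∈ middleCantor l := by
  induction k with
  | zero => simpa using hx
  | succ k ih => simpa [pow_succ', mul_assoc] using mul_mem_middleCantor hl ih

theorem zero_mem_middleCantor {l : ℝ} : (0 : ℝ) ∈ middleCantor l := by
  refine mem_iInter.2 fun n => ?_
  induction n with
  | zero => exact ⟨le_rfl, zero_le_one⟩
  | succ n ih => exact Or.inl ⟨0, ih, by simp⟩

theorem one_mem_middleCantor {l : ℝ} : (1 : ℝ) ∈ middleCantor l := by
  refine mem_iInter.2 fun n => ?_
  induction n with
  | zero => exact ⟨zero_le_one, le_rfl⟩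
  | succ n ih => exact Or.inr ⟨1, ih, by simp⟩

theorem one_sub_mem_middleCantor {l : ℝ} (hl : 0 < l ∧ l < 1 / 2) : 1 - l ∈ middleCantor l := by
  simpa using mul_add_mem_middleCantor hl zero_mem_middleCantor

/-- A nonzero point of the Cantor set is a power of the ratio times a point of `[1 - l, 1]`. -/
theorem exists_eq_pow_mul_of_mem_middleCantor {l x : ℝ} (hl : 0 < l ∧ l < 1 / 2)
    (hx : x ∈ middleCantor l) (hx0 : x ≠ 0) :
    ∃ k : ℕ, ∃ y ∈ Icc (1 - l) 1, x = l ^ k * y := by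
  have hpos : 0 < x := lt_of_le_of_ne (middleCantor_subset_Icc hx).1 hx0.symm
  -- `N` bounds the number of divisions by `l`: each one turns `l ^ (N + 1) < x` into `l ^ N < x /
  -- l`.
  obtain ⟨N, hN⟩ := exists_pow_lt_of_lt_one hpos (show l < 1 by linarith [hl.2])
  clear hx0 hpos
  induction N generalizing x with
  | zero => exact absurd (middleCantor_subset_Icc hx).2 (by simpa using hN)
  | succ N ih =>
    have h := hx
    rw [(middleCantor_isAttractor hl).eq_union] at h
    obtain ⟨y, hy, rfl⟩ | ⟨y, hy, rfl⟩ := h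
    · obtain ⟨k, w, hw, rfl⟩ := ih hy (by
        rw [pow_succ'] at hN
        exact lt_of_mul_lt_mul_left hN hl.1.le)
      exact ⟨k + 1, w, hw, by rw [pow_succ', mul_assoc]⟩
    · refine ⟨0, l * y + (1 - l), ⟨?_, (middleCantor_subset_Icc hx).2⟩, by simp⟩
      have := mul_nonneg hl.1.le (middleCantor_subset_Icc hy).1
      linarith

/-! ### Joint subdivision of two Cantor sets. -/

/-- The interval `[a, a + l ^ m]` carries a scaled copy of the Cantor set inside `[1 - l, 1]`. -/
structure IsCylinder (l : ℝ) (m : ℕ) (a : ℝ) : Prop where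
  le : 1 - l ≤ a
  mem : ∀ x ∈ middleCantor l, a + l ^ m * x ∈ middleCantor l

namespace IsCylinder

variable {l a : ℝ} {m : ℕ}

theorem one_sub (hl : 0 < l ∧ l < 1 / 2) : IsCylinder l 1 (1 - l) :=
  ⟨le_rfl, fun x hx => by
    rw [pow_one, add_comm]
    exact mul_add_mem_middleCantor hl hx⟩

theorem left_mem (h : IsCylinder l m a) : a ∈ middleCantor l := by
  simpa using h.mem 0 zero_mem_middleCantor

theorem add_pow_le_one (h : IsCylinder l m a) : a + l ^ m ≤ 1 := by
  simpa using (middleCantor_subset_Icc (h.mem 1 one_mem_middleCantor)).2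

theorem left (hl : 0 < l ∧ l < 1 / 2) (h : IsCylinder l m a) : IsCylinder l (m + 1) a :=
  ⟨h.le, fun x hx => by
    rw [pow_succ, mul_assoc]
    exact h.mem _ (mul_mem_middleCantor hl hx)⟩

theorem right (hl : 0 < l ∧ l < 1 / 2) (h : IsCylinder l m a) :
    IsCylinder l (m + 1) (a + (1 - l) * l ^ m) :=
  ⟨h.le.trans (le_add_of_nonneg_right (mul_nonneg (by linarith [hl.2]) (pow_nonneg hl.1.le m))),
    fun x hx => by
      have := h.mem _ (mul_add_mem_middleCantor hl hx)
      rwa [show a + (1 - l) * l ^ m + l ^ (m + 1) * x = a + l ^ m * (l * x + (1 - l)) by ring]⟩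

end IsCylinder

/-- Subdividing two Cantor sets: a relation on pairs of intervals which passes to one of the halves
whenever the removed gap is relatively smaller than the other interval holds for pairs of
arbitrarily small cylinders. -/
theorem exists_small_cylinders {l₁ l₂ : ℝ} (h₁ : 0 < l₁ ∧ l₁ < 1 / 2) (h₂ : 0 < l₂ ∧ l₂ < 1 / 2)
    (h12 : 1 - 2 * l₁ ≤ l₁ * (1 - l₂)) (h21 : 1 - 2 * l₂ ≤ l₂ * (1 - l₁))
    (P : ℝ → ℝ → ℝ → ℝ → Prop) (h0 : P (1 - l₁) 1 (1 - l₂) 1)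
    (hP₁ : ∀ a c' c a' b b', 0 < b → b ≤ b' → c * b ≤ c' * b' → P a a' b b' →
      P a c' b b' ∨ P c a' b b')
    (hP₂ : ∀ a a' b c' c b', 0 < a → a ≤ a' → c * a ≤ c' * a' → P a a' b b' →
      P a a' b c' ∨ P a a' c b')
    {r : ℝ} (hr : 0 < r) :
    ∃ a s b t, a ∈ middleCantor l₁ ∧ 1 - l₁ ≤ a ∧ b ∈ middleCantor l₂ ∧ 1 - l₂ ≤ b ∧
      0 ≤ s ∧ s < r ∧ 0 ≤ t ∧ t < r ∧ P a (a + s) b (b + t) := by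
  -- `h12` reads `1 ≤ l₁ * (3 - l₂)`, so both ratios exceed 1/3; inserting `l₂ ≥ 1/3` gives 3/8.
  have hl₁ : 3 / 8 ≤ l₁ := by nlinarith [h₁.1, h₂.1, h₁.2, h₂.2]
  have hl₂ : 3 / 8 ≤ l₂ := by nlinarith [h₁.1, h₂.1, h₁.2, h₂.2]
  -- With normalised lengths `S = l₁ ^ m / (1 - l₁)` and `T = l₂ ^ n / (1 - l₂)`, the last two
  -- conditions say `l₂ * T ≤ S` and `l₁ * S ≤ T`: neither interval becomes too short to bridge a
  -- gap in the other.
  have key : ∀ N : ℕ, ∃ m n a b, m + n = N + 2 ∧ IsCylinder l₁ m a ∧ IsCylinder l₂ n b ∧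
      P a (a + l₁ ^ m) b (b + l₂ ^ n) ∧
      l₂ * (1 - l₁) * l₂ ^ n ≤ (1 - l₂) * l₁ ^ m ∧
      l₁ * (1 - l₂) * l₁ ^ m ≤ (1 - l₁) * l₂ ^ n := by
    intro N
    induction N with
    | zero =>
      refine ⟨1, 1, 1 - l₁, 1 - l₂, rfl, .one_sub h₁, .one_sub h₂, by simpa using h0, ?_, ?_⟩
      · nlinarith [mul_nonneg h₂.1.le (sub_nonneg.2 h₂.2.le), mul_pos h₁.1 h₂.1]
      · nlinarith [mul_nonneg h₁.1.le (sub_nonneg.2 h₁.2.le), mul_pos h₁.1 h₂.1]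
    | succ N ih =>
      obtain ⟨m, n, a, b, hmn, ha, hb, hP, hi, hj⟩ := ih
      have ha1 := ha.add_pow_le_one
      have hb1 := hb.add_pow_le_one
      have hal := ha.le
      have hbl := hb.le
      have hs : 0 < l₁ ^ m := pow_pos h₁.1 m
      have ht : 0 < l₂ ^ n := pow_pos h₂.1 n
      have hst := mul_pos hs ht
      -- Cut the interval whose normalised length stays larger after cutting; this preserves both
      -- conditions.
      rcases le_total (l₂ * (1 - l₁) * l₂ ^ n) (l₁ * (1 - l₂) * l₁ ^ m) with hle | hle
      · have hj' : l₁ * (1 - l₂) * l₁ ^ (m + 1) ≤ (1 - l₁) * l₂ ^ n := by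
          rw [pow_succ]
          nlinarith [mul_nonneg (sub_nonneg.2 (show l₁ ≤ 1 by linarith))
            (mul_nonneg (mul_nonneg h₁.1.le (sub_nonneg.2 (show l₂ ≤ 1 by linarith))) hs.le)]
        have hi' : l₂ * (1 - l₁) * l₂ ^ n ≤ (1 - l₂) * l₁ ^ (m + 1) := by
          rw [pow_succ]
          linarith
        -- With `s = l₁ ^ m`, `t = l₂ ^ n`: `(1 - 2l₁)sb ≤ (1 - 2l₁)s ≤ l₁(1 - l₂)s ≤ (1 - l₁)t ≤
        -- at`.
        have hgap : (a + (1 - l₁) * l₁ ^ m) * b ≤ (a + l₁ * l₁ ^ m) * (b + l₂ ^ n) := by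
          have e1 : (1 - 2 * l₁) * l₁ ^ m * b ≤ (1 - 2 * l₁) * l₁ ^ m :=
            mul_le_of_le_one_right (mul_nonneg (by linarith) hs.le) (by linarith)
          have e2 := mul_le_mul_of_nonneg_right h12 hs.le
          have e3 := mul_le_mul_of_nonneg_right hal ht.le
          nlinarith [mul_pos h₁.1 hst]
        rcases hP₁ a (a + l₁ * l₁ ^ m) (a + (1 - l₁) * l₁ ^ m) _ b _ (by linarith) (by linarith)
          hgap hP with h | h
        · exact ⟨m + 1, n, a, b, by omega, ha.left h₁, hb, by rwa [pow_succ'], hi', hj'⟩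
        · exact ⟨m + 1, n, _, b, by omega, ha.right h₁, hb, by
            rwa [show a + (1 - l₁) * l₁ ^ m + l₁ ^ (m + 1) = a + l₁ ^ m by ring], hi', hj'⟩
      · have hi' : l₂ * (1 - l₁) * l₂ ^ (n + 1) ≤ (1 - l₂) * l₁ ^ m := by
          rw [pow_succ]
          nlinarith [mul_nonneg (sub_nonneg.2 (show l₂ ≤ 1 by linarith))
            (mul_nonneg (mul_nonneg h₂.1.le (sub_nonneg.2 (show l₁ ≤ 1 by linarith))) ht.le)]
        have hj' : l₁ * (1 - l₂) * l₁ ^ m ≤ (1 - l₁) * l₂ ^ (n + 1) := by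
          rw [pow_succ]
          linarith
        have hgap : (b + (1 - l₂) * l₂ ^ n) * a ≤ (b + l₂ * l₂ ^ n) * (a + l₁ ^ m) := by
          have e1 : (1 - 2 * l₂) * l₂ ^ n * a ≤ (1 - 2 * l₂) * l₂ ^ n :=
            mul_le_of_le_one_right (mul_nonneg (by linarith) ht.le) (by linarith)
          have e2 := mul_le_mul_of_nonneg_right h21 ht.le
          have e3 := mul_le_mul_of_nonneg_right hbl hs.le
          nlinarith [mul_pos h₂.1 hst]
        rcases hP₂ a _ b (b + l₂ * l₂ ^ n) (b + (1 - l₂) * l₂ ^ n) _ (by linarith) (by linarith)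
          hgap hP with h | h
        · exact ⟨m, n + 1, a, b, by omega, ha, hb.left h₂, by rwa [pow_succ'], hi', hj'⟩
        · exact ⟨m, n + 1, a, _, by omega, ha, hb.right h₂, by
            rwa [show b + (1 - l₂) * l₂ ^ n + l₂ ^ (n + 1) = b + l₂ ^ n by ring], hi', hj'⟩
  obtain ⟨N, hN⟩ := exists_pow_lt_of_lt_one (show 0 < r ^ 2 / 4 by positivity)
    (show (1 / 2 : ℝ) < 1 by norm_num)
  obtain ⟨m, n, a, b, hmn, ha, hb, hP, hi, hj⟩ := key N
  have hs : 0 < l₁ ^ m := pow_pos h₁.1 m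
  have ht : 0 < l₂ ^ n := pow_pos h₂.1 n
  have hst : l₁ ^ m * l₂ ^ n < r ^ 2 / 4 := by
    calc l₁ ^ m * l₂ ^ n ≤ (1 / 2) ^ m * (1 / 2) ^ n := by
          exact mul_le_mul (pow_le_pow_left₀ h₁.1.le h₁.2.le m)
            (pow_le_pow_left₀ h₂.1.le h₂.2.le n) ht.le (by positivity)
      _ = (1 / 2) ^ (N + 2) := by rw [← pow_add, hmn]
      _ ≤ (1 / 2) ^ N := pow_le_pow_of_le_one (by norm_num) (by norm_num) (by omega)
      _ < _ := hN
  -- The lengths are comparable, so a small product makes both small: each square is at most four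
  -- times the product, hence below `r ^ 2`.
  have hs4 : l₁ ^ m ≤ 4 * l₂ ^ n := by
    have e1 : 3 / 16 ≤ l₁ * (1 - l₂) := by nlinarith
    nlinarith [mul_le_mul_of_nonneg_right e1 hs.le]
  have ht4 : l₂ ^ n ≤ 4 * l₁ ^ m := by
    have e1 : 3 / 16 ≤ l₂ * (1 - l₁) := by nlinarith
    nlinarith [mul_le_mul_of_nonneg_right e1 ht.le]
  exact ⟨a, _, b, _, ha.left_mem, ha.le, hb.left_mem, hb.le, hs.le,
    lt_of_pow_lt_pow_left₀ 2 hr.le (by nlinarith), ht.le,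
    lt_of_pow_lt_pow_left₀ 2 hr.le (by nlinarith), hP⟩

/-- A continuous equation with approximate solutions in the upper parts of two Cantor sets
has an exact solution there. -/
theorem exists_eq_zero_of_approx {l₁ l₂ : ℝ} (h₁ : 0 < l₁ ∧ l₁ < 1 / 2)
    (h₂ : 0 < l₂ ∧ l₂ < 1 / 2) (f : ℝ × ℝ → ℝ) (hf : Continuous f)
    (happ : ∀ r > 0, ∃ x ∈ middleCantor l₁, ∃ y ∈ middleCantor l₂,
      1 - l₁ ≤ x ∧ 1 - l₂ ≤ y ∧ |f (x, y)| ≤ r) :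
    ∃ x ∈ middleCantor l₁, ∃ y ∈ middleCantor l₂, 1 - l₁ ≤ x ∧ 1 - l₂ ≤ y ∧ f (x, y) = 0 := by
  have hc : IsCompact ((middleCantor l₁ ∩ Ici (1 - l₁)) ×ˢ (middleCantor l₂ ∩ Ici (1 - l₂))) :=
    ((middleCantor_isAttractor h₁).isCompact.inter_right isClosed_Ici).prod
      ((middleCantor_isAttractor h₂).isCompact.inter_right isClosed_Ici)
  have h0 : (0 : ℝ) ∈ f '' ((middleCantor l₁ ∩ Ici (1 - l₁)) ×ˢ
      (middleCantor l₂ ∩ Ici (1 - l₂))) := by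
    rw [← (hc.image hf).isClosed.closure_eq, Metric.mem_closure_iff]
    intro r hr
    obtain ⟨x, hx, y, hy, hx1, hy1, hxy⟩ := happ (r / 2) (half_pos hr)
    refine ⟨f (x, y), ⟨(x, y), ⟨⟨hx, hx1⟩, ⟨hy, hy1⟩⟩, rfl⟩, ?_⟩
    rw [dist_comm, Real.dist_eq, sub_zero]
    linarith
  obtain ⟨⟨x, y⟩, ⟨⟨hx, hx1⟩, ⟨hy, hy1⟩⟩, hxy⟩ := h0
  exact ⟨x, hx, y, hy, hx1, hy1, hxy⟩

/-! ### Products and quotients of two Cantor sets. -/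

theorem exists_mul_eq {l₁ l₂ z : ℝ} (h₁ : 0 < l₁ ∧ l₁ < 1 / 2) (h₂ : 0 < l₂ ∧ l₂ < 1 / 2)
    (h12 : 1 - 2 * l₁ ≤ l₁ * (1 - l₂)) (h21 : 1 - 2 * l₂ ≤ l₂ * (1 - l₁))
    (hz : (1 - l₁) * (1 - l₂) ≤ z) (hz1 : z ≤ 1) :
    ∃ x ∈ middleCantor l₁, ∃ y ∈ middleCantor l₂, 1 - l₁ ≤ x ∧ 1 - l₂ ≤ y ∧ x * y = z := by
  obtain ⟨x, hx, y, hy, hx1, hy1, hxy⟩ := exists_eq_zero_of_approx h₁ h₂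
    (fun p => p.1 * p.2 - z) (by fun_prop) (fun r hr => by
      obtain ⟨a, s, b, t, ha, ha1, hb, hb1, hs, hsr, ht, htr, hP, hP'⟩ :=
        exists_small_cylinders h₁ h₂ h12 h21 (fun a a' b b' => a * b ≤ z ∧ z ≤ a' * b')
          ⟨hz, by simpa using hz1⟩
          (fun a c' c a' b b' hb hbb hc hP => by
            rcases le_total z (c' * b') with h | h
            · exact Or.inl ⟨hP.1, h⟩
            · exact Or.inr ⟨hc.trans h, hP.2⟩)
          (fun a a' b c' c b' ha haa hc hP => by
            rcases le_total z (a' * c') with h | h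
            · exact Or.inl ⟨hP.1, h⟩
            · exact Or.inr ⟨by linarith, hP.2⟩)
          -- The error is at most `s * b + t * a + s * t ≤ 2 * s + t < r`, using `t < 1`.
          (show 0 < min 1 (r / 3) from lt_min one_pos (by positivity))
      refine ⟨a, ha, b, hb, ha1, hb1, ?_⟩
      have ha' := middleCantor_subset_Icc ha
      have hb' := middleCantor_subset_Icc hb
      have hs1 := lt_min_iff.1 hsr
      have ht1 := lt_min_iff.1 htr
      dsimp only
      rw [abs_le]
      constructor <;> nlinarith [ha'.1, ha'.2, hb'.1, hb'.2,
        mul_nonneg hs (sub_nonneg.2 hb'.2), mul_nonneg ht (sub_nonneg.2 ha'.2),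
        mul_nonneg hs (sub_nonneg.2 ht1.1.le)])
  exact ⟨x, hx, y, hy, hx1, hy1, sub_eq_zero.1 hxy⟩

/-- Here the relation is `z ∈ [a / b', a' / b]`. The quotient ranges of the two halves overlap under
the same inequality `c * b ≤ c' * b'` as the product ranges. -/
theorem exists_eq_mul {l₁ l₂ z : ℝ} (h₁ : 0 < l₁ ∧ l₁ < 1 / 2) (h₂ : 0 < l₂ ∧ l₂ < 1 / 2)
    (h12 : 1 - 2 * l₁ ≤ l₁ * (1 - l₂)) (h21 : 1 - 2 * l₂ ≤ l₂ * (1 - l₁))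
    (hz : 1 - l₁ ≤ z) (hz1 : z * (1 - l₂) ≤ 1) :
    ∃ x ∈ middleCantor l₁, ∃ y ∈ middleCantor l₂, 1 - l₁ ≤ x ∧ 1 - l₂ ≤ y ∧ x = z * y := by
  have hz0 : 0 < z := by linarith [h₁.2]
  have hz2 : z ≤ 2 := by nlinarith [h₂.2]
  obtain ⟨x, hx, y, hy, hx1, hy1, hxy⟩ := exists_eq_zero_of_approx h₁ h₂
    (fun p => p.1 - z * p.2) (by fun_prop) (fun r hr => by
      obtain ⟨a, s, b, t, ha, ha1, hb, hb1, hs, hsr, ht, htr, hP, hP'⟩ :=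
        exists_small_cylinders h₁ h₂ h12 h21 (fun a a' b b' => a ≤ z * b' ∧ z * b ≤ a')
          ⟨by simpa using hz, hz1⟩
          (fun a c' c a' b b' hb hbb hc hP => by
            rcases le_total (z * b) c' with h | h
            · exact Or.inl ⟨hP.1, h⟩
            · refine Or.inr ⟨?_, hP.2⟩
              have := mul_le_mul_of_nonneg_right h (hb.le.trans hbb)
              exact le_of_mul_le_mul_right (by linarith) hb)
          (fun a a' b c' c b' ha haa hc hP => by
            rcases le_total a (z * c') with h | h
            · exact Or.inl ⟨h, hP.2⟩
            · refine Or.inr ⟨hP.1, ?_⟩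
              have e1 := mul_le_mul_of_nonneg_right h (ha.le.trans haa)
              have e2 := mul_le_mul_of_nonneg_left hc hz0.le
              exact le_of_mul_le_mul_right (by linarith) ha)
          (show 0 < r / 2 from half_pos hr)
      refine ⟨a, ha, b, hb, ha1, hb1, ?_⟩
      dsimp only
      rw [abs_le]
      constructor <;> nlinarith [mul_nonneg ht (sub_nonneg.2 hz2)])
  exact ⟨x, hx, y, hy, hx1, hy1, sub_eq_zero.1 hxy⟩

/-! ### Two factors with arbitrary signs. -/

/-- The least value of `x ^ e` for `x ∈ [1 - l, 1]` and `e = ±1`. -/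
noncomputable def lowerFactor (l : ℝ) (e : ℤ) : ℝ := if e = 1 then 1 - l else 1

/-- The greatest value of `x ^ e` for `x ∈ [1 - l, 1]` and `e = ±1`. -/
noncomputable def upperFactor (l : ℝ) (e : ℤ) : ℝ := if e = -1 then (1 - l)⁻¹ else 1

theorem lowerFactor_pos {l : ℝ} (hl : l < 1 / 2) (e : ℤ) : 0 < lowerFactor l e := by
  unfold lowerFactor
  split_ifs <;> linarith

theorem upperFactor_pos {l : ℝ} (hl : l < 1 / 2) (e : ℤ) : 0 < upperFactor l e := by
  have : 0 < 1 - l := by linarith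
  unfold upperFactor
  split_ifs <;> positivity

theorem lowerFactor_eq {l : ℝ} (hl : l < 1 / 2) {e : ℤ} (he : e = 1 ∨ e = -1) :
    lowerFactor l e = (1 - l) * upperFactor l e := by
  have : 1 - l ≠ 0 := by linarith
  rcases he with rfl | rfl <;> simp [lowerFactor, upperFactor, this]

theorem zpow_mem_Icc_factor {l x : ℝ} (hl : l < 1 / 2) {e : ℤ} (he : e = 1 ∨ e = -1)
    (hx : x ∈ Icc (1 - l) 1) : x ^ e ∈ Icc (lowerFactor l e) (upperFactor l e) := by
  have h1 : 0 < 1 - l := by linarith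
  rcases he with rfl | rfl
  · simpa [lowerFactor, upperFactor] using hx
  · simp only [lowerFactor, upperFactor, zpow_neg, zpow_one, reduceCtorEq, if_true]
    exact ⟨by simpa using one_le_inv₀ (h1.trans_le hx.1) |>.2 hx.2, inv_anti₀ h1 hx.1⟩

theorem exists_zpow_eq_lowerFactor {l : ℝ} (hl : 0 < l ∧ l < 1 / 2) {e : ℤ}
    (he : e = 1 ∨ e = -1) :
    ∃ x ∈ middleCantor l, 1 - l ≤ x ∧ x ^ e = lowerFactor l e := by
  rcases he with rfl | rfl
  · exact ⟨1 - l, one_sub_mem_middleCantor hl, le_rfl, by simp [lowerFactor]⟩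
  · exact ⟨1, one_mem_middleCantor, by linarith [hl.1], by simp [lowerFactor]⟩

theorem exists_zpow_eq_upperFactor {l : ℝ} (hl : 0 < l ∧ l < 1 / 2) {e : ℤ}
    (he : e = 1 ∨ e = -1) :
    ∃ x ∈ middleCantor l, 1 - l ≤ x ∧ x ^ e = upperFactor l e := by
  rcases he with rfl | rfl
  · exact ⟨1, one_mem_middleCantor, by linarith [hl.1], by simp [upperFactor]⟩
  · exact ⟨1 - l, one_sub_mem_middleCantor hl, le_rfl, by simp [upperFactor]⟩

theorem exists_zpow_mul_zpow_eq {l₁ l₂ z : ℝ} (h₁ : 0 < l₁ ∧ l₁ < 1 / 2)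
    (h₂ : 0 < l₂ ∧ l₂ < 1 / 2)
    (h12 : 1 - 2 * l₁ ≤ l₁ * (1 - l₂)) (h21 : 1 - 2 * l₂ ≤ l₂ * (1 - l₁))
    {e₁ e₂ : ℤ} (he₁ : e₁ = 1 ∨ e₁ = -1) (he₂ : e₂ = 1 ∨ e₂ = -1)
    (hz : lowerFactor l₁ e₁ * lowerFactor l₂ e₂ ≤ z)
    (hz1 : z ≤ upperFactor l₁ e₁ * upperFactor l₂ e₂) :
    ∃ x ∈ middleCantor l₁, ∃ y ∈ middleCantor l₂,
      1 - l₁ ≤ x ∧ 1 - l₂ ≤ y ∧ x ^ e₁ * y ^ e₂ = z := by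
  have p₁ : 0 < 1 - l₁ := by linarith [h₁.2]
  have p₂ : 0 < 1 - l₂ := by linarith [h₂.2]
  have hz0 : 0 < z := (mul_pos (lowerFactor_pos h₁.2 e₁) (lowerFactor_pos h₂.2 e₂)).trans_le hz
  rcases he₁ with rfl | rfl <;> rcases he₂ with rfl | rfl <;>
    simp [lowerFactor, upperFactor] at hz hz1
  · simpa using exists_mul_eq h₁ h₂ h12 h21 hz hz1
  · obtain ⟨x, hx, y, hy, hx1, hy1, hxy⟩ := exists_eq_mul (z := z) h₁ h₂ h12 h21 (by linarith)
      (by rwa [← le_div_iff₀ p₂, one_div])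
    have : y ≠ 0 := by linarith
    exact ⟨x, hx, y, hy, hx1, hy1, by rw [hxy]; field_simp⟩
  · obtain ⟨y, hy, x, hx, hy1, hx1, hxy⟩ := exists_eq_mul (z := z) h₂ h₁ h21 h12 (by linarith)
      (by rwa [← le_div_iff₀ p₁, one_div])
    have : x ≠ 0 := by linarith
    exact ⟨x, hx, y, hy, hx1, hy1, by rw [hxy]; field_simp⟩
  · obtain ⟨x, hx, y, hy, hx1, hy1, hxy⟩ := exists_mul_eq (z := z⁻¹) h₁ h₂ h12 h21
      (by rw [le_inv_comm₀ (mul_pos p₁ p₂) hz0, mul_inv]; linarith) (inv_le_one_of_one_le₀ hz)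
    exact ⟨x, hx, y, hy, hx1, hy1, by
      rw [zpow_neg_one, zpow_neg_one, ← mul_inv, hxy, inv_inv]⟩

/-! ### Adding further factors. -/

/-- The range statement for a set of factors; it is propagated by adding factors one at a time. -/
def FactorsFill {ι : Type*} (l : ι → ℝ) (e : ι → ℤ) (T : Finset ι) : Prop :=
  2 * ∏ i ∈ T, lowerFactor (l i) (e i) ≤ ∏ i ∈ T, upperFactor (l i) (e i) ∧
  ∀ z, ∏ i ∈ T, lowerFactor (l i) (e i) ≤ z → z ≤ ∏ i ∈ T, upperFactor (l i) (e i) →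
    ∃ x : ι → ℝ, (∀ i, x i ∈ middleCantor (l i)) ∧ (∀ i, 1 - l i ≤ x i) ∧
      ∏ i ∈ T, x i ^ e i = z

/-- The new factor is used only at its extreme values `lo` and `up`. Since `up ≤ 2 * lo`, while the
old range has ratio at least 2, its multiples by `lo` and `up` overlap and cover the new range. -/
theorem FactorsFill.insert {ι : Type*} [DecidableEq ι] {l : ι → ℝ} {e : ι → ℤ} {T : Finset ι}
    (hl : ∀ i, 0 < l i ∧ l i < 1 / 2) (he : ∀ i, e i = 1 ∨ e i = -1)
    (hT : FactorsFill l e T) {j : ι} (hj : j ∉ T) : FactorsFill l e (insert j T) := by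
  obtain ⟨hT2, hT⟩ := hT
  have hlo := lowerFactor_pos (hl j).2 (e j)
  have hup := upperFactor_pos (hl j).2 (e j)
  have heq := lowerFactor_eq (hl j).2 (he j)
  have hle : lowerFactor (l j) (e j) ≤ upperFactor (l j) (e j) := by nlinarith [(hl j).1]
  have hp : 0 < ∏ i ∈ T, lowerFactor (l i) (e i) :=
    Finset.prod_pos fun i _ => lowerFactor_pos (hl i).2 _
  have extend : ∀ v w, v ∈ middleCantor (l j) → 1 - l j ≤ v →
      ∏ i ∈ T, lowerFactor (l i) (e i) ≤ w → w ≤ ∏ i ∈ T, upperFactor (l i) (e i) →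
      ∃ x : ι → ℝ, (∀ i, x i ∈ middleCantor (l i)) ∧ (∀ i, 1 - l i ≤ x i) ∧
        x j ^ e j * ∏ i ∈ T, x i ^ e i = v ^ e j * w := by
    intro v w hv hv1 hw hw1
    obtain ⟨x, hx, hx1, hxw⟩ := hT w hw hw1
    refine ⟨Function.update x j v, fun i => ?_, fun i => ?_, ?_⟩
    · rcases eq_or_ne i j with rfl | hij
      · simpa using hv
      · simpa [hij] using hx i
    · rcases eq_or_ne i j with rfl | hij
      · simpa using hv1
      · simpa [hij] using hx1 i
    · rw [Function.update_self, ← hxw]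
      congr 1
      refine Finset.prod_congr rfl fun i hi => ?_
      rw [Function.update_of_ne (ne_of_mem_of_not_mem hi hj)]
  unfold FactorsFill
  simp only [Finset.prod_insert hj]
  refine ⟨by nlinarith, fun z hz hz1 => ?_⟩
  rcases le_total (upperFactor (l j) (e j) * ∏ i ∈ T, lowerFactor (l i) (e i)) z with h | h
  · obtain ⟨v, hv, hv1, hve⟩ := exists_zpow_eq_upperFactor (hl j) (he j)
    have := extend v (z / upperFactor (l j) (e j)) hv hv1
      (by rwa [le_div_iff₀' hup]) (by rwa [div_le_iff₀' hup])
    rwa [hve, mul_div_cancel₀ _ hup.ne'] at this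
  · obtain ⟨v, hv, hv1, hve⟩ := exists_zpow_eq_lowerFactor (hl j) (he j)
    have := extend v (z / lowerFactor (l j) (e j)) hv hv1
      (by rwa [le_div_iff₀' hlo]) (by
        rw [div_le_iff₀' hlo]
        have e1 : upperFactor (l j) (e j) ≤ 2 * lowerFactor (l j) (e j) := by
          nlinarith [(hl j).2]
        nlinarith [mul_le_mul_of_nonneg_right e1 hp.le, mul_le_mul_of_nonneg_left hT2 hlo.le])
    rwa [hve, mul_div_cancel₀ _ hlo.ne'] at this

theorem factorsFill_pair {ι : Type*} [DecidableEq ι] {l : ι → ℝ} {e : ι → ℤ}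
    (hl : ∀ i, 0 < l i ∧ l i < 1 / 2) (he : ∀ i, e i = 1 ∨ e i = -1) {p q : ι} (hpq : p ≠ q)
    (h12 : 1 - 2 * l p ≤ l p * (1 - l q)) (h21 : 1 - 2 * l q ≤ l q * (1 - l p)) :
    FactorsFill l e {p, q} := by
  unfold FactorsFill
  simp only [Finset.prod_pair hpq]
  have hup := mul_pos (upperFactor_pos (hl p).2 (e p)) (upperFactor_pos (hl q).2 (e q))
  constructor
  · rw [lowerFactor_eq (hl p).2 (he p), lowerFactor_eq (hl q).2 (he q)]
    have : 2 * ((1 - l p) * (1 - l q)) ≤ 1 := by nlinarith [(hl p).1, (hl q).1, (hl p).2, (hl q).2]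
    nlinarith [mul_le_mul_of_nonneg_right this hup.le]
  · intro z hz hz1
    obtain ⟨x, hx, y, hy, hx1, hy1, hxy⟩ :=
      exists_zpow_mul_zpow_eq (hl p) (hl q) h12 h21 (he p) (he q) hz hz1
    -- The coordinates outside the pair are also constrained, so they get the filler 1.
    refine ⟨fun i => if i = p then x else if i = q then y else 1, fun i => ?_, fun i => ?_, ?_⟩
    · dsimp only
      split_ifs with h h'
      · rwa [h]
      · rwa [h']
      · exact one_mem_middleCantor
    · dsimp only
      split_ifs with h h'
      · rwa [h]
      · rwa [h']
      · linarith [(hl i).1]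
    · simpa [hpq.symm] using hxy

theorem factorsFill_univ {ι : Type*} [Fintype ι] [DecidableEq ι] {l : ι → ℝ} {e : ι → ℤ}
    (hl : ∀ i, 0 < l i ∧ l i < 1 / 2) (he : ∀ i, e i = 1 ∨ e i = -1) {p q : ι} (hpq : p ≠ q)
    (h12 : 1 - 2 * l p ≤ l p * (1 - l q)) (h21 : 1 - 2 * l q ≤ l q * (1 - l p)) :
    FactorsFill l e Finset.univ := by
  have key : ∀ S : Finset ι, FactorsFill l e (S ∪ {p, q}) := by
    intro S
    induction S using Finset.induction_on with
    | empty => simpa using factorsFill_pair hl he hpq h12 h21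
    | insert j S _ ih =>
      rw [Finset.insert_union]
      by_cases hj : j ∈ S ∪ {p, q}
      · rwa [Finset.insert_eq_of_mem hj]
      · exact ih.insert hl he hj
  simpa using key Finset.univ

/-! ### The mixed product set. -/

theorem corollary1p6 (n : ℕ) (hn : 1 ≤ n) (l : Fin (n + 1) → ℝ)
    (hl : ∀ i, 0 < l i ∧ l i < 1 / 2)
    (h : ∀ i, i < Fin.last n →
      (1 - 2 * l i) / l i ≤ 1 - l (Fin.last n) ∧
      1 / (1 - l i) ≤ l (Fin.last n) / (1 - 2 * l (Fin.last n)))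
    (e : Fin (n + 1) → ℤ) (he : ∀ i, e i = 1 ∨ e i = -1) (hpos : ∃ i, e i = 1) :
    mixedProduct (fun i => middleCantor (l i)) e =
      (⋃ k : Fin (n + 1) → ℕ, (fun t : ℝ => (∏ i, l i ^ (e i * (k i : ℤ))) * t) ''
        Icc (∏ i with e i = 1, (1 - l i)) (∏ i with e i = -1, (1 - l i)⁻¹)) ∪ {0} := by
  have hδ : ∏ i with e i = 1, (1 - l i) = ∏ i, lowerFactor (l i) (e i) := Finset.prod_filter _ _
  have hη : ∏ i with e i = -1, (1 - l i)⁻¹ = ∏ i, upperFactor (l i) (e i) :=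
    Finset.prod_filter _ _
  rw [hδ, hη]
  have hsplit : ∀ (k : Fin (n + 1) → ℕ) (x : Fin (n + 1) → ℝ),
      (∏ i, l i ^ (e i * (k i : ℤ))) * ∏ i, x i ^ e i = ∏ i, (l i ^ k i * x i) ^ e i := by
    intro k x
    rw [← Finset.prod_mul_distrib]
    refine Finset.prod_congr rfl fun i _ => ?_
    rw [mul_zpow, mul_comm (e i), zpow_mul, zpow_natCast]
  apply Subset.antisymm
  · rintro y ⟨x, hx, -, rfl⟩
    -- Since `0⁻¹ = 0`, a zero coordinate kills the product whatever its exponent.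
    by_cases h0 : ∃ i, x i = 0
    · obtain ⟨i, hi⟩ := h0
      refine Or.inr (Finset.prod_eq_zero (Finset.mem_univ i) ?_)
      rw [hi]
      exact zero_zpow _ (by rcases he i with h | h <;> rw [h] <;> decide)
    · push Not at h0
      choose k w hw hxw using fun i => exists_eq_pow_mul_of_mem_middleCantor (hl i) (hx i) (h0 i)
      refine Or.inl (mem_iUnion.2 ⟨k, ∏ i, w i ^ e i, ?_, ?_⟩)
      · have hmem := fun i => zpow_mem_Icc_factor (hl i).2 (he i) (hw i)
        have hlo := fun i => (lowerFactor_pos (hl i).2 (e i)).le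
        exact ⟨Finset.prod_le_prod (fun i _ => hlo i) fun i _ => (hmem i).1,
          Finset.prod_le_prod (fun i _ => (hlo i).trans (hmem i).1) fun i _ => (hmem i).2⟩
      · dsimp only
        rw [hsplit]
        simp only [← hxw]
  · rintro y (hy | rfl)
    · obtain ⟨k, t, ht, rfl⟩ := mem_iUnion.1 hy
      have hlast : (0 : Fin (n + 1)) < Fin.last n := by
        rw [Fin.lt_def]
        simpa using Nat.pos_of_ne_zero (by omega)
      obtain ⟨ha, hb⟩ := h 0 hlast
      rw [div_le_iff₀ (hl 0).1] at ha
      rw [div_le_div_iff₀ (by linarith [(hl 0).2]) (by linarith [(hl (Fin.last n)).2])] at hb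
      obtain ⟨x, hx, hx1, hxt⟩ := (factorsFill_univ hl he hlast.ne (by linarith)
        (by linarith)).2 t ht.1 ht.2
      refine ⟨fun i => l i ^ k i * x i, fun i => pow_mul_mem_middleCantor (hl i) (hx i) _,
        fun i _ => mul_ne_zero (pow_pos (hl i).1 _).ne' ?_, ?_⟩
      · linarith [hx1 i, (hl i).2]
      · dsimp only
        rw [← hxt, hsplit]
    -- The value 0 comes from a coordinate with exponent 1; coordinates with exponent -1 must stay
    -- nonzero.
    · refine ⟨fun i => if e i = 1 then 0 else 1, fun i => ?_, fun i hi => ?_, ?_⟩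
      · dsimp only
        split_ifs
        exacts [zero_mem_middleCantor, one_mem_middleCantor]
      · simp [hi]
      · obtain ⟨i, hi⟩ := hpos
        exact (Finset.prod_eq_zero (Finset.mem_univ i) (by simp [hi])).symm
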